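/- \textbf{Theorem.} Let $d\ge 2$, let $\Delta_d=\{\theta\in[0,1]^d:\sum_{i}\theta_i=1\}$, and for $\theta\in\Delta_d$ let $\mathbf p_\theta$ be the distribution on $[d]=\{1,\dots,d\}$ with $\mathbf p_\theta(j)=\theta_j$. Consider $n\ge 1$ players; player $t$ observes $X_t$, where $X_1,\dots,X_n$ are i.i.d. with law $\mathbf p_\theta$ and $\theta\in\Delta_d$ is unknown. In a \emph{sequentially interactive protocol} with message space $\mathcal Y$ there are public randomness $U$ and private randomness $U_1,\dots,U_n$, mutually independent and independent of the samples. In round $t=1,\dots,n$, player $t$ selects, as a function of $(U,U_t)$, an allowed channel $W_t$, i.e. a Markov kernel from $[d]\times\mathcal Y^{t-1}$ to $\mathcal Y$, and sends a message $Y_t\in\mathcal Y$ drawn from $W_t(\cdot\mid X_t,Y_1,\dots,Y_{t-1})$. An estimator $\hat\theta$ is a measurable function of the transcript $(Y_1,\dots,Y_n,U)$ with values in $\Delta_d$. Two constraints on the allowed channels are considered. (a) \emph{$\varepsilon$-local differential privacy} ($\varepsilon>0$): the message space $\mathcal Y$ is an arbitrary measurable space, and the allowed channels $W_t$ are those with $W_t(S\mid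 x_1,y)\le e^{\varepsilon}\,W_t(S\mid x_2,y)$ for all measurable $S\subseteq\mathcal Y$, all $y\in\mathcal Y^{t-1}$ and all $x_1,x_2\in[d]$. (b) \emph{$\ell$-bit communication} (integer $\ell\ge 1$): $\mathcal Y=\{0,1\}^\ell$, and all channels are allowed. For $p\in[1,\infty)$ let $\mathcal E_p$ denote the minimax error rate, that is, the infimum of all $\delta\in(0,1]$ for which there are a protocol using allowed channels and an estimator $\hat\theta$ with $$\Big(\mathbb E_\theta\big[\|\theta-\hat\theta(Y_1,\dots,Y_n,U)\|_p^p\big]\Big)^{1/p}\le\delta\qquad\text{for all }\theta\in\Delta_d$$ (and $\mathcal E_p=\infty$ if there is no such $\delta$). There is an absolute constant $c>0$ such that, for all $p\in[1,\infty)$, $d\ge 2$, $n\ge 1$: \begin{enumerate} \item for every $\varepsilon>0$, and for every message space $\mathcal Y$, under $\varepsilon$-local differential privacy, $$\mathcal E_p\ \ge\ c\left(\sqrt{\frac{d^{2/p}}{n\big((e^\varepsilon-1)^2\wedge e^\varepsilon\big)}\wedge\Big(\frac{1}{n\big((e^\varepsilon-1)^2\wedge e^\varepsilon\big)}\Big)^{\frac{p-1}{p}}}\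 \wedge\ 1\right);$$ \item for every integer $\ell\ge 1$, under $\ell$-bit communication, $$\mathcal E_p\ \ge\ c\left(\sqrt{\frac{d^{2/p}}{n2^\ell}\wedge\Big(\frac{1}{n2^\ell}\Big)^{\frac{p-1}{p}}}\ \wedge\ 1\right).$$ \end{enumerate} -/

import Mathlib

open MeasureTheory ProbabilityTheory
open scoped ENNReal

universe u v w

namespace InteractiveEstimation

noncomputable section

/-- A channel used by player `t` (players are numbered `0, 1, ..., n - 1`) is a Markov kernel which,
given the player's sample `x : X` and the `t` previous messages, outputs a message in `Y`.
A family of channels specifies, for every `t`, which channels player `t` is allowed to use. -/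
abbrev ChannelFamily (X : Type v) (Y : Type u) [MeasurableSpace X] [MeasurableSpace Y] :=
  (t : ℕ) → Set (Kernel (X × (Fin t → Y)) Y)

/-- The family of all `ε`-locally differentially private channels with output space `Y`. -/
def ldpChannels (X : Type v) (Y : Type u) [MeasurableSpace X] [MeasurableSpace Y] (ε : ℝ) :
    ChannelFamily X Y := fun t =>
  {W | IsMarkovKernel W ∧ ∀ S : Set Y, MeasurableSet S → ∀ (y : Fin t → Y) (x₁ x₂ : X),
    W (x₁, y) S ≤ ENNReal.ofReal (Real.exp ε) * W (x₂, y) S}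

/-- The family of all (randomized) channels whose messages are strings of `ℓ` bits. -/
def commChannels (X : Type v) [MeasurableSpace X] (ℓ : ℕ) :
    ChannelFamily X (Fin ℓ → Bool) := fun _ =>
  {W | IsMarkovKernel W}

/-- A sequentially interactive protocol for `n` players using the channel family `𝒲`.
`U` is the public randomness (with law `lawU`), `V t` the private randomness of player `t` (with
law `lawV t`). Player `t` selects the channel `channel t ((u, v), ·)` in `𝒲 t`
from the public randomness `u` and the private randomness `v`. -/
structure Protocol {X : Type v} {Y : Type u} [MeasurableSpace X] [MeasurableSpace Y]
    (𝒲 : ChannelFamily X Y) (n : ℕ) where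
  /-- the space of the public randomness -/
  U : Type w
  [measU : MeasurableSpace U]
  /-- the law of the public randomness -/
  lawU : ProbabilityMeasure U
  /-- the spaces of the private randomness -/
  V : Fin n → Type w
  [measV : ∀ t, MeasurableSpace (V t)]
  /-- the laws of the private randomness -/
  lawV : (t : Fin n) → ProbabilityMeasure (V t)
  /-- the channels, as functions of the public and the private randomness -/
  channel : (t : Fin n) → Kernel ((U × V t) × (X × (Fin t → Y))) Y
  channel_markov : ∀ t, IsMarkovKernel (channel t)
  channel_mem : ∀ (t : Fin n) (u : U) (v : V t), (channel t).sectR (u, v) ∈ 𝒲 t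

attribute [instance] Protocol.measU Protocol.measV Protocol.channel_markov

namespace Protocol

variable {X : Type v} {Y : Type u} [MeasurableSpace X] [MeasurableSpace Y]
  {𝒲 : ChannelFamily X Y} {n : ℕ}

/-- Round `t` of the protocol, when the samples have law `P`: given the public randomness `u` and
the previous messages `y`, draw the private randomness `v` of player `t` and the
sample `x ∼ P` of player `t`, independently of each other and of all that came before, and send a
message drawn from the selected channel at `(x, y)`. -/
def round (pr : Protocol.{u, v, w} 𝒲 n) (P : ProbabilityMeasure X) (t : ℕ) (ht : t < n) :
    Kernel (pr.U × (Fin t → Y)) Y :=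
  pr.channel ⟨t, ht⟩ ∘ₖ
    ((Kernel.id ×ₖ Kernel.const _ ((pr.lawV ⟨t, ht⟩ : Measure _).prod (P : Measure X))).map
      (fun q : (pr.U × (Fin t → Y)) × (pr.V ⟨t, ht⟩ × X) => ((q.1.1, q.2.1), (q.2.2, q.1.2))))

/-- The conditional law of the first `m` messages given the public randomness, when the samples
of the players are i.i.d. with law `P`. -/
def messages (pr : Protocol.{u, v, w} 𝒲 n) (P : ProbabilityMeasure X) :
    (m : ℕ) → m ≤ n → Kernel pr.U (Fin m → Y)
  | 0, _ => Kernel.const _ (Measure.dirac (fun i => i.elim0))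
  | m + 1, h =>
      (pr.messages P m (Nat.le_of_succ_le h) ⊗ₖ pr.round P m h).map
        (fun q => Fin.snoc (α := fun _ => Y) q.1 q.2)

/-- The law of the transcript (public randomness and all `n` messages), when the samples of the
players are i.i.d. with law `P`. -/
def transcript (pr : Protocol.{u, v, w} 𝒲 n) (P : ProbabilityMeasure X) :
    Measure (pr.U × (Fin n → Y)) :=
  (pr.lawU : Measure pr.U) ⊗ₘ pr.messages P n le_rfl

end Protocol

/-- The `ℓ_p` distance on `ℝ^d`, for finite `p`. -/
def lpDist {d : ℕ} (p : ℝ) (a b : Fin d → ℝ) : ℝ :=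
  (∑ i, |a i - b i| ^ p) ^ (1 / p)

/-- `θhat`, a measurable function of the transcript of `pr` with values in `Θ`, is an
`(n, δ)`-estimator under `ℓ_p` loss for the family `(P θ)`, `θ ∈ Θ`:
for every `θ ∈ Θ`, the `p`-th root of the expected `p`-th power of the loss is at most `δ`. -/
def IsEstimator {X : Type v} {Y : Type u} [MeasurableSpace X] [MeasurableSpace Y]
    {d : ℕ} {Θ : Set (Fin d → ℝ)} (P : Θ → ProbabilityMeasure X) {𝒲 : ChannelFamily X Y} {n : ℕ}
    (p δ : ℝ) (pr : Protocol.{u, v, w} 𝒲 n) (θhat : pr.U × (Fin n → Y) → Θ) : Prop :=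
  Measurable θhat ∧ ∀ θ : Θ,
    (∫⁻ τ, ENNReal.ofReal (lpDist p θ.1 (θhat τ).1) ^ p ∂(pr.transcript (P θ))) ^ (1 / p)
      ≤ ENNReal.ofReal δ

/-- The minimax error rate of estimation under `ℓ_p` loss: the infimum of all `δ ∈ (0, 1]` for which
there is an `(n, δ)`-estimator using `𝒲` (and `∞` if there is none). -/
def minimaxRate {X : Type v} {Y : Type u} [MeasurableSpace X] [MeasurableSpace Y]
    {d : ℕ} {Θ : Set (Fin d → ℝ)} (p : ℝ) (P : Θ → ProbabilityMeasure X) (𝒲 : ChannelFamily X Y)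
    (n : ℕ) : ℝ≥0∞ :=
  sInf (ENNReal.ofReal '' {δ : ℝ | 0 < δ ∧ δ ≤ 1 ∧
    ∃ (pr : Protocol.{u, v, w} 𝒲 n) (θhat : pr.U × (Fin n → Y) → Θ), IsEstimator P p δ pr θhat})

/-- The family of all distributions on `[d]`, parameterized by their probability mass functions. -/
def discreteDist (d : ℕ) (θ : stdSimplex ℝ (Fin d)) : ProbabilityMeasure (Fin d) :=
  ⟨∑ j, ENNReal.ofReal (θ.1 j) • Measure.dirac j, ⟨by
    simp only [Measure.finsetSum_apply, Measure.smul_apply, measure_univ, smul_eq_mul, mul_one]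
    rw [← ENNReal.ofReal_sum_of_nonneg (fun j _ => θ.2.1 j), θ.2.2, ENNReal.ofReal_one]⟩⟩

/-- The bound `√(d^(2/p) / N ∧ (1 / N)^((p - 1) / p)) ∧ 1`. -/
def discreteBound (p : ℝ) (d : ℕ) (N : ℝ) : ℝ :=
  min (√(min ((d : ℝ) ^ (2 / p) / N) ((1 / N) ^ ((p - 1) / p)))) 1

end

end InteractiveEstimation

/-!
The proof is Assouad's method on a hypercube of perturbed uniform distributions, with a chain rule
for the Kullback-Leibler divergence that respects interaction.

Pair up `2 k ≤ d` symbols, and for `z ∈ {0, 1}^k` let `θ_z` shift a fraction `γ ≤ 1 / 3` of the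
mass of each pair towards the symbol selected by `z` (`cubePoint`). The coordinates of an
estimator that belong to the `i`-th pair err by `γ / (2 k)` at `z` or at its `i`-th neighbour
(`flipCoord z i`), and they must do so often if the transcript laws at these two vertices are
close.

To bound the divergences, fix `z`, and let `Q` be the law of the transcript up to and including a
round when the samples follow `θ_z`. If `w_a` denotes the density with respect to `Q` of the law
of the transcript conditioned on the sample of this round being `a`, the round multiplies the
likelihood ratio of the `i`-th neighbour by `1 ± (γ / k) (w_(i, true) - w_(i, false))`. Minus the
logarithm of this factor has expectation `O((γ / k) ^ 2 E (w_(i, true) - w_(i, false)) ^ 2)`, and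
the sum of these over `i` is `O(γ ^ 2 B / k)` (`exists_logLikelihoodRatio`), with
`B = min ((e ^ ε - 1) ^ 2) (e ^ ε)` under local differential privacy and `B = 2 ^ ℓ` for `ℓ` bits. The reason is
that the densities `w_a` have average `1` and differ by at most `e ^ ε - 1`, or that `max_a w_a`
has expectation at most `B` (`HasInformationBound`, `sum_integral_sq_rnDeriv_sub_le`). Only
densities of measures on the space of transcripts are used, never densities of kernels; hence the
message space can be arbitrary.

After `n` rounds the divergences between `z` and its `k` neighbours are `O(γ ^ 2 n B / k ^ 2)` on
average (`Protocol.exists_logLikelihoodRatio`), which is a small constant for `γ` of order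
`k / √(n B)`. Averaging over `z` gives an `ℓ_p` error of order `k ^ (1 / p) γ / k`
(`rpow_le_of_isEstimator`), and `k` of order `min d √(n B)` gives the stated rate
(`exists_parameters`).
-/

namespace InteractiveEstimation

noncomputable section

/-! ### The hypercube of perturbed uniform distributions -/

/-- The vertex of the hypercube `{0, 1}^k` that differs from `z` in the coordinate `i` only. -/
def flipCoord {k : ℕ} (z : Fin k → Bool) (i : Fin k) : Fin k → Bool := Function.update z i (!z i)

/-- The weights of the perturbed uniform distribution indexed by the vertex `z` of the hypercube.
The alphabet consists of `k` pairs `(i, false)`, `(i, true)`; within the `i`-th pair, a fraction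
`γ` of the mass is shifted towards the symbol `(i, z i)`. -/
def cubeWeight {k : ℕ} (γ : ℝ) (z : Fin k → Bool) (a : Fin k × Bool) : ℝ :=
  (1 + γ * (if z a.1 = a.2 then 1 else -1)) / (2 * k)

lemma flipCoord_self {k : ℕ} (z : Fin k → Bool) (i : Fin k) : flipCoord z i i = !z i := by
  simp [flipCoord]

lemma flipCoord_of_ne {k : ℕ} (z : Fin k → Bool) {i j : Fin k} (h : j ≠ i) :
    flipCoord z i j = z j := by
  simp [flipCoord, h]

lemma flipCoord_flipCoord {k : ℕ} (z : Fin k → Bool) (i : Fin k) :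
    flipCoord (flipCoord z i) i = z := by
  simp [flipCoord]

section Weights

variable {k : ℕ} {γ : ℝ}

lemma sum_cubeWeight (hk : 0 < k) (z : Fin k → Bool) : ∑ a, cubeWeight γ z a = 1 := by
  have hk' : (k : ℝ) ≠ 0 := by positivity
  have h : ∀ i, ∑ b, cubeWeight γ z (i, b) = 1 / k := by
    intro i
    rw [Fintype.sum_bool]
    unfold cubeWeight
    cases z i <;> simp <;> field_simp <;> ring
  rw [Fintype.sum_prod_type]
  rw [Finset.sum_congr rfl fun i _ => h i]
  simp [hk']

lemma one_div_le_cubeWeight (hγ : γ ≤ 1 / 3) (hγ0 : 0 ≤ γ) (z : Fin k → Bool) (a : Fin k × Bool) :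
    1 / (3 * k) ≤ cubeWeight γ z a := by
  have : (1 : ℝ) / (3 * k) = (2 / 3) / (2 * k) := by
    by_cases h : (k : ℝ) = 0
    · simp [h]
    · field_simp
  rw [this, cubeWeight]
  gcongr
  split_ifs <;> linarith

lemma cubeWeight_pos (hk : 0 < k) (hγ : γ ≤ 1 / 3) (hγ0 : 0 ≤ γ) (z : Fin k → Bool)
    (a : Fin k × Bool) : 0 < cubeWeight γ z a :=
  lt_of_lt_of_le (by positivity) (one_div_le_cubeWeight hγ hγ0 z a)

lemma cubeWeight_le_two_mul (hγ : γ ≤ 1 / 3) (hγ0 : 0 ≤ γ) (z z' : Fin k → Bool)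
    (a : Fin k × Bool) : cubeWeight γ z a ≤ 2 * cubeWeight γ z' a := by
  unfold cubeWeight
  rw [← mul_div_assoc]
  gcongr
  split_ifs <;> linarith

/-- Flipping one coordinate moves mass `γ / k` within one pair of symbols. -/
lemma sq_sum_cubeWeight_flip_sub (z : Fin k → Bool) (i : Fin k) (w : Fin k × Bool → ℝ) :
    (∑ a, cubeWeight γ (flipCoord z i) a * w a - ∑ a, cubeWeight γ z a * w a) ^ 2
      = (γ / k) ^ 2 * (w (i, true) - w (i, false)) ^ 2 := by
  have h : ∑ a, cubeWeight γ (flipCoord z i) a * w a - ∑ a, cubeWeight γ z a * w a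
      = ∑ b, (cubeWeight γ (flipCoord z i) (i, b) - cubeWeight γ z (i, b)) * w (i, b) := by
    rw [← Finset.sum_sub_distrib, Fintype.sum_prod_type, Finset.sum_eq_single i]
    · exact Finset.sum_congr rfl fun b _ => by ring
    · intro j _ hj
      refine Finset.sum_eq_zero fun b _ => ?_
      simp [cubeWeight, flipCoord_of_ne z hj]
    · simp
  rw [h, Fintype.sum_bool]
  by_cases hk : (k : ℝ) = 0
  · simp [cubeWeight, hk]
  unfold cubeWeight
  simp only [flipCoord_self]
  cases z i <;> simp <;> field_simp <;> ring

end Weights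

/-! ### Densities of mixtures -/

section Density

variable {T : Type*} [MeasurableSpace T]

lemma rnDeriv_mono {μ ν : Measure T} [IsFiniteMeasure μ] [IsFiniteMeasure ν] (Q : Measure T)
    [IsFiniteMeasure Q] (h : μ ≤ ν) : μ.rnDeriv Q ≤ᵐ[Q] ν.rnDeriv Q := by
  have h1 := Measure.rnDeriv_add (ν - μ) μ Q
  rw [Measure.sub_add_cancel_of_le h] at h1
  filter_upwards [h1] with t ht
  rw [ht]
  exact le_add_self

/-- The mixture of the measures `ν a` with weights `q a`. -/
def mixture {α : Type*} [Fintype α] (q : α → ℝ) (ν : α → Measure T) : Measure T :=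
  ∑ a, ENNReal.ofReal (q a) • ν a

/-- A bound for the information that a message reveals about the sample. Here `ν a` is the law of
the message (and of whatever was known before it) when the sample is `a`. Either the laws `ν a`
have a common upper bound of mass at most `B`, or they agree up to a factor `1 + √B`. -/
def HasInformationBound {α : Type*} (B : ℝ) (ν : α → Measure T) : Prop :=
  (∃ Λ : Measure T, Λ Set.univ ≤ ENNReal.ofReal B ∧ ∀ a, ν a ≤ Λ) ∨
    ∃ r : ℝ, 0 ≤ r ∧ r ^ 2 = B ∧ ∀ a b, ν a ≤ ENNReal.ofReal (1 + r) • ν b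

lemma isProbabilityMeasure_mixture {α : Type*} [Fintype α] {q : α → ℝ} (hq : ∀ a, 0 ≤ q a)
    (hq1 : ∑ a, q a = 1) (ν : α → Measure T) [∀ a, IsProbabilityMeasure (ν a)] :
    IsProbabilityMeasure (mixture q ν) := by
  constructor
  simp only [mixture, Measure.finsetSum_apply, Measure.smul_apply, measure_univ, smul_eq_mul,
    mul_one]
  rw [← ENNReal.ofReal_sum_of_nonneg (fun a _ => hq a), hq1, ENNReal.ofReal_one]

lemma absolutelyContinuous_mixture {α : Type*} [Fintype α] {q : α → ℝ} {ν : α → Measure T} {a : α}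
    (hq : 0 < q a) : ν a ≪ mixture q ν := by
  refine Measure.AbsolutelyContinuous.mk fun s _ h => ?_
  simp only [mixture, Measure.finsetSum_apply, Measure.smul_apply, smul_eq_mul,
    Finset.sum_eq_zero_iff, Finset.mem_univ, true_implies, mul_eq_zero] at h
  exact (h a).resolve_left (by simpa using hq)

/-- If all `ν a` have densities with respect to `Q`, so has every mixture of them. -/
lemma mixture_eq_withDensity {α : Type*} [Fintype α] {q : α → ℝ} (hq : ∀ a, 0 ≤ q a)
    {ν : α → Measure T} [∀ a, IsFiniteMeasure (ν a)] {Q : Measure T} [IsFiniteMeasure Q]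
    (hν : ∀ a, ν a ≪ Q) :
    mixture q ν = Q.withDensity
      (fun t => ENNReal.ofReal (∑ a, q a * ((ν a).rnDeriv Q t).toReal)) := by
  have hae : ∀ᵐ t ∂Q, ∀ a, (ν a).rnDeriv Q t < ∞ :=
    ae_all_iff.2 fun a => Measure.rnDeriv_lt_top (ν a) Q
  have h1 : (fun t => ENNReal.ofReal (∑ a, q a * ((ν a).rnDeriv Q t).toReal))
      =ᵐ[Q] fun t => ∑ a, ENNReal.ofReal (q a) * (ν a).rnDeriv Q t := by
    filter_upwards [hae] with t ht
    rw [ENNReal.ofReal_sum_of_nonneg fun a _ => mul_nonneg (hq a) ENNReal.toReal_nonneg]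
    refine Finset.sum_congr rfl fun a _ => ?_
    rw [ENNReal.ofReal_mul (hq a), ENNReal.ofReal_toReal (ht a).ne]
  rw [withDensity_congr_ae h1]
  ext s hs
  rw [withDensity_apply _ hs, lintegral_finsetSum _ fun a _ => by fun_prop]
  simp only [mixture, Measure.finsetSum_apply, Measure.smul_apply, smul_eq_mul]
  refine Finset.sum_congr rfl fun a _ => ?_
  rw [lintegral_const_mul _ (Measure.measurable_rnDeriv _ _), Measure.setLIntegral_rnDeriv (hν a)]

lemma ae_sum_mul_rnDeriv_mixture {α : Type*} [Fintype α] {q : α → ℝ} (hq : ∀ a, 0 < q a)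
    {ν : α → Measure T} [∀ a, IsFiniteMeasure (ν a)] [IsFiniteMeasure (mixture q ν)] :
    ∀ᵐ t ∂mixture q ν, ∑ a, q a * ((ν a).rnDeriv (mixture q ν) t).toReal = 1 := by
  have h := mixture_eq_withDensity (fun a => (hq a).le)
    (fun a => absolutelyContinuous_mixture (ν := ν) (hq a))
  have h2 : (mixture q ν).withDensity
      (fun t => ENNReal.ofReal (∑ a, q a * ((ν a).rnDeriv (mixture q ν) t).toReal))
      = (mixture q ν).withDensity 1 := by rw [← h, withDensity_one]
  rw [withDensity_eq_iff_of_sigmaFinite (by fun_prop) (by fun_prop)] at h2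
  filter_upwards [h2] with t ht
  exact ENNReal.ofReal_eq_one.1 ht

/-- The information bound in terms of densities: on average over the `k` pairs of symbols, the two
densities of a pair are within `O(√B)` of each other in mean square. -/
lemma sum_integral_sq_rnDeriv_sub_le {k : ℕ} (hk : 0 < k) {B : ℝ} (hB0 : 0 ≤ B)
    {q : Fin k × Bool → ℝ} (hq : ∀ a, 1 / (3 * k) ≤ q a) (hq1 : ∑ a, q a = 1)
    {ν : Fin k × Bool → Measure T} [∀ a, IsProbabilityMeasure (ν a)]
    [IsProbabilityMeasure (mixture q ν)] (hB : HasInformationBound B ν) :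
    ∑ i, ∫ t, (((ν (i, true)).rnDeriv (mixture q ν) t).toReal
      - ((ν (i, false)).rnDeriv (mixture q ν) t).toReal) ^ 2 ∂mixture q ν ≤ 3 * k * B := by
  set Q := mixture q ν with hQ
  have hq0 : ∀ a, 0 < q a := fun a => lt_of_lt_of_le (by positivity) (hq a)
  have hsum := ae_sum_mul_rnDeriv_mixture (ν := ν) hq0
  rw [← hQ] at hsum
  have hfin : ∀ᵐ t ∂Q, ∀ a, (ν a).rnDeriv Q t < ∞ :=
    ae_all_iff.2 fun a => Measure.rnDeriv_lt_top (ν a) Q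
  set w : Fin k × Bool → T → ℝ := fun a t => ((ν a).rnDeriv Q t).toReal with hw
  have hwm : ∀ a, Measurable (w a) := fun a => by fun_prop
  have hw0 : ∀ a t, 0 ≤ w a t := fun a t => ENNReal.toReal_nonneg
  have hk' : (0 : ℝ) < k := by positivity
  -- A normalized density is at most `1 / q a ≤ 3 k`, so that all integrands are bounded.
  have hws : ∀ᵐ t ∂Q, ∑ a, w a t ≤ 3 * k := by
    filter_upwards [hsum] with t ht
    have : (1 / (3 * k : ℝ)) * ∑ a, w a t ≤ 1 := by
      refine le_of_le_of_eq ?_ ht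
      rw [Finset.mul_sum]
      exact Finset.sum_le_sum fun a _ => mul_le_mul_of_nonneg_right (hq a) (hw0 a t)
    rw [one_div, inv_mul_le_iff₀ (by positivity)] at this
    linarith
  have hint : ∀ i, Integrable (fun t => (w (i, true) t - w (i, false) t) ^ 2) Q := by
    intro i
    refine Integrable.of_bound (by fun_prop) ((3 * k : ℝ) ^ 2) ?_
    filter_upwards [hws] with t ht
    have h1 : ∀ a, w a t ≤ 3 * k := fun a =>
      (Finset.single_le_sum (fun b _ => hw0 b t) (Finset.mem_univ a)).trans ht
    rw [Real.norm_eq_abs, abs_of_nonneg (sq_nonneg _), sq_le_sq, abs_of_nonneg (a := (3 * k : ℝ))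
      (by positivity), abs_le]
    constructor <;> linarith [h1 (i, true), h1 (i, false), hw0 (i, true) t, hw0 (i, false) t]
  rw [← integral_finsetSum _ fun i _ => hint i]
  rcases hB with ⟨Λ, hΛB, hΛ⟩ | ⟨r, hr0, rfl, hr⟩
  · have : IsFiniteMeasure Λ := ⟨hΛB.trans_lt ENNReal.ofReal_lt_top⟩
    have hle : ∀ᵐ t ∂Q, ∀ a, (ν a).rnDeriv Q t ≤ Λ.rnDeriv Q t :=
      ae_all_iff.2 fun a => rnDeriv_mono Q (hΛ a)
    have hΛi : ∫ t, (Λ.rnDeriv Q t).toReal ∂Q ≤ B := by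
      rw [integral_toReal (by fun_prop) (Measure.rnDeriv_lt_top Λ Q)]
      exact ENNReal.toReal_le_of_le_ofReal hB0 (Measure.lintegral_rnDeriv_le.trans hΛB)
    calc ∫ t, ∑ i, (w (i, true) t - w (i, false) t) ^ 2 ∂Q
        ≤ ∫ t, 3 * k * (Λ.rnDeriv Q t).toReal ∂Q := by
          refine integral_mono_ae (integrable_finsetSum _ fun i _ => hint i)
            (Measure.integrable_toReal_rnDeriv.const_mul _) ?_
          filter_upwards [hws, hle, Measure.rnDeriv_lt_top Λ Q] with t h1 h2 h3
          have h4 : ∀ a, w a t ≤ (Λ.rnDeriv Q t).toReal := fun a =>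
            ENNReal.toReal_mono h3.ne (h2 a)
          calc ∑ i, (w (i, true) t - w (i, false) t) ^ 2
              ≤ ∑ i, ∑ b, w (i, b) t * (Λ.rnDeriv Q t).toReal := by
                refine Finset.sum_le_sum fun i _ => ?_
                rw [Fintype.sum_bool]
                nlinarith [h4 (i, true), h4 (i, false), hw0 (i, true) t, hw0 (i, false) t,
                  mul_nonneg (hw0 (i, true) t) (hw0 (i, false) t)]
            _ = (∑ a, w a t) * (Λ.rnDeriv Q t).toReal := by
                rw [← Fintype.sum_prod_type' (fun i b => w (i, b) t * (Λ.rnDeriv Q t).toReal),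
                  Finset.sum_mul]
            _ ≤ 3 * k * (Λ.rnDeriv Q t).toReal := by gcongr
      _ ≤ 3 * k * B := by
          rw [integral_const_mul]
          gcongr
  · have hle : ∀ᵐ t ∂Q, ∀ a b, (ν a).rnDeriv Q t ≤ ENNReal.ofReal (1 + r) * (ν b).rnDeriv Q t := by
      refine ae_all_iff.2 fun a => ae_all_iff.2 fun b => ?_
      have : IsFiniteMeasure (ENNReal.ofReal (1 + r) • ν b) :=
        Measure.smul_finite _ ENNReal.ofReal_ne_top
      filter_upwards [rnDeriv_mono Q (hr a b), Measure.rnDeriv_smul_left_of_ne_top (ν b) Q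
        (r := ENNReal.ofReal (1 + r)) ENNReal.ofReal_ne_top] with t h1 h2
      rw [h2] at h1
      simpa using h1
    calc ∫ t, ∑ i, (w (i, true) t - w (i, false) t) ^ 2 ∂Q
        ≤ ∫ _, k * r ^ 2 ∂Q := by
          refine integral_mono_ae (integrable_finsetSum _ fun i _ => hint i)
            (integrable_const _) ?_
          filter_upwards [hsum, hle, hfin] with t h1 h2 h3
          have h4 : ∀ a b, w a t ≤ (1 + r) * w b t := by
            intro a b
            have := ENNReal.toReal_mono
              (ENNReal.mul_ne_top ENNReal.ofReal_ne_top (h3 b).ne) (h2 a b)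
            rwa [ENNReal.toReal_mul, ENNReal.toReal_ofReal (by positivity)] at this
          have : Nonempty (Fin k × Bool) := ⟨(⟨0, hk⟩, true)⟩
          obtain ⟨m, -, hm⟩ := Finset.exists_min_image Finset.univ (fun a => w a t)
            Finset.univ_nonempty
          -- The smallest density is at most the average density, which is `1`.
          have hm1 : w m t ≤ 1 := by
            calc w m t = ∑ a, q a * w m t := by rw [← Finset.sum_mul, hq1, one_mul]
              _ ≤ ∑ a, q a * w a t := Finset.sum_le_sum fun a _ =>
                  mul_le_mul_of_nonneg_left (hm a (Finset.mem_univ a)) (hq0 a).le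
              _ = 1 := h1
          have h5 : ∀ a a', w a t - w a' t ≤ r := by
            intro a a'
            nlinarith [h4 a m, hm a' (Finset.mem_univ a')]
          calc ∑ i, (w (i, true) t - w (i, false) t) ^ 2 ≤ ∑ _i : Fin k, r ^ 2 := by
                refine Finset.sum_le_sum fun i _ => sq_le_sq.2 ?_
                rw [abs_of_nonneg hr0, abs_le]
                constructor <;> linarith [h5 (i, true) (i, false), h5 (i, false) (i, true)]
            _ = k * r ^ 2 := by simp
      _ ≤ 3 * k * r ^ 2 := by
          simp only [integral_const, probReal_univ, smul_eq_mul, one_mul]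
          nlinarith [mul_nonneg hk'.le (sq_nonneg r)]

end Density

/-! ### One round: the likelihood ratios between neighbouring vertices -/

lemma neg_log_le {x : ℝ} (hx : 1 / 2 ≤ x) : -Real.log x ≤ 1 - x + 2 * (x - 1) ^ 2 := by
  have hx0 : 0 < x := by linarith
  have h := Real.one_sub_inv_le_log_of_pos hx0
  have h2 : x⁻¹ ≤ 2 - x + 2 * (x - 1) ^ 2 := by
    rw [inv_le_iff_one_le_mul₀' hx0]
    nlinarith [mul_nonneg (sq_nonneg (x - 1)) (by linarith : 0 ≤ 2 * x - 1)]
  linarith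

section OneRound

variable {T : Type*} [MeasurableSpace T]

/-- The quadratic bound on the likelihood ratios between a vertex of the hypercube and its
neighbours, when a single sample is observed through the laws `ν`. -/
lemma exists_likelihoodRatio {k : ℕ} (hk : 0 < k) {γ : ℝ} (hγ0 : 0 ≤ γ) (hγ : γ ≤ 1 / 3)
    (z : Fin k → Bool) {B : ℝ} (hB0 : 0 ≤ B) (ν : Fin k × Bool → Measure T)
    [∀ a, IsProbabilityMeasure (ν a)] (hB : HasInformationBound B ν) :
    ∃ D : Fin k → T → ℝ, (∀ i, Measurable (D i)) ∧ (∀ i t, 1 / 2 ≤ D i t ∧ D i t ≤ 2) ∧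
      (∀ i, mixture (cubeWeight γ (flipCoord z i)) ν
        = (mixture (cubeWeight γ z) ν).withDensity (fun t => ENNReal.ofReal (D i t))) ∧
      ∑ i, ∫ t, (D i t - 1) ^ 2 ∂mixture (cubeWeight γ z) ν ≤ 3 * γ ^ 2 * B / k := by
  have hpos : ∀ z a, 0 < cubeWeight γ z a := fun z a => cubeWeight_pos (k := k) hk hγ hγ0 z a
  have hprob : IsProbabilityMeasure (mixture (cubeWeight γ z) ν) :=
    isProbabilityMeasure_mixture (fun a => (hpos z a).le) (sum_cubeWeight hk z) ν
  have hJ := sum_integral_sq_rnDeriv_sub_le hk hB0 (one_div_le_cubeWeight hγ hγ0 z)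
    (sum_cubeWeight hk z) hB
  have hsum := ae_sum_mul_rnDeriv_mixture (ν := ν) (hpos z)
  have hdens := fun i => mixture_eq_withDensity (fun a => (hpos (flipCoord z i) a).le)
    (fun a => absolutelyContinuous_mixture (ν := ν) (hpos z a))
  set Q := mixture (cubeWeight γ z) ν with hQ
  have hk' : (k : ℝ) ≠ 0 := by positivity
  set S : Fin k → T → ℝ :=
    fun i t => ∑ a, cubeWeight γ (flipCoord z i) a * ((ν a).rnDeriv Q t).toReal with hS
  have hSm : ∀ i, Measurable (S i) := fun i => by fun_prop
  have hclamp : ∀ i, (fun t => max (1 / 2) (min 2 (S i t))) =ᵐ[Q] S i := by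
    intro i
    filter_upwards [hsum] with t ht
    have h1 : S i t ≤ 2 := by
      rw [← mul_one 2, ← ht, Finset.mul_sum]
      refine Finset.sum_le_sum fun a _ => ?_
      rw [← mul_assoc]
      exact mul_le_mul_of_nonneg_right (cubeWeight_le_two_mul hγ hγ0 _ _ a) ENNReal.toReal_nonneg
    have h2 : 1 ≤ 2 * S i t := by
      rw [← ht, Finset.mul_sum]
      refine Finset.sum_le_sum fun a _ => ?_
      rw [← mul_assoc]
      exact mul_le_mul_of_nonneg_right (cubeWeight_le_two_mul hγ hγ0 _ _ a) ENNReal.toReal_nonneg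
    rw [min_eq_right h1, max_eq_right (by linarith)]
  -- `S i` is a density; clamping it changes it on a null set only and makes its bounds hold
  -- everywhere.
  refine ⟨fun i t => max (1 / 2) (min 2 (S i t)), fun i => by fun_prop, fun i t =>
    ⟨le_max_left _ _, max_le (by norm_num) (min_le_left _ _)⟩, fun i => ?_, ?_⟩
  · rw [hdens i]
    refine withDensity_congr_ae ?_
    filter_upwards [hclamp i] with t ht
    rw [ht]
  · calc ∑ i, ∫ t, (max (1 / 2) (min 2 (S i t)) - 1) ^ 2 ∂Q
        = ∑ i, (γ / k) ^ 2 * ∫ t, (((ν (i, true)).rnDeriv Q t).toReal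
            - ((ν (i, false)).rnDeriv Q t).toReal) ^ 2 ∂Q := by
          refine Finset.sum_congr rfl fun i _ => ?_
          rw [← integral_const_mul]
          refine integral_congr_ae ?_
          filter_upwards [hclamp i, hsum] with t h1 h2
          rw [h1, ← sq_sum_cubeWeight_flip_sub z i (fun a => ((ν a).rnDeriv Q t).toReal), h2]
      _ ≤ (γ / k) ^ 2 * (3 * k * B) := by
          rw [← Finset.mul_sum]
          gcongr
      _ = 3 * γ ^ 2 * B / k := by
          field_simp

/-- The log-likelihood ratios contributed by one sample: they are bounded, and their expectations,
which are Kullback-Leibler divergences, are small on average over the neighbours. -/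
lemma exists_logLikelihoodRatio {k : ℕ} (hk : 0 < k) {γ : ℝ} (hγ0 : 0 ≤ γ) (hγ : γ ≤ 1 / 3)
    (z : Fin k → Bool) {B : ℝ} (hB0 : 0 ≤ B) (ν : Fin k × Bool → Measure T)
    [∀ a, IsProbabilityMeasure (ν a)] (hB : HasInformationBound B ν) :
    ∃ L : Fin k → T → ℝ, (∀ i, Measurable (L i)) ∧ (∀ i t, |L i t| ≤ 1) ∧
      (∀ i, mixture (cubeWeight γ (flipCoord z i)) ν
        = (mixture (cubeWeight γ z) ν).withDensity (fun t => ENNReal.ofReal (Real.exp (-L i t)))) ∧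
      ∑ i, ∫ t, L i t ∂mixture (cubeWeight γ z) ν ≤ 6 * γ ^ 2 * B / k := by
  have hpos : ∀ z a, 0 < cubeWeight γ z a := fun z a => cubeWeight_pos (k := k) hk hγ hγ0 z a
  have hprob : ∀ z, IsProbabilityMeasure (mixture (cubeWeight γ z) ν) := fun z =>
    isProbabilityMeasure_mixture (fun a => (hpos z a).le) (sum_cubeWeight hk z) ν
  obtain ⟨D, hDm, hD, hdens, hJ⟩ := exists_likelihoodRatio hk hγ0 hγ z hB0 ν hB
  have hD0 : ∀ i t, 0 < D i t := fun i t => by linarith [(hD i t).1]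
  have hlog : ∀ i t, |-Real.log (D i t)| ≤ 1 := by
    intro i t
    rw [abs_neg, abs_le]
    constructor
    · have := Real.one_sub_inv_le_log_of_pos (hD0 i t)
      have h2 : (D i t)⁻¹ ≤ 2 := by
        rw [inv_le_comm₀ (hD0 i t) (by norm_num)]
        linarith [(hD i t).1]
      linarith
    · linarith [Real.log_le_sub_one_of_pos (hD0 i t), (hD i t).2]
  refine ⟨fun i t => -Real.log (D i t), fun i => by fun_prop, hlog, fun i => ?_, ?_⟩
  · simp only [neg_neg, Real.exp_log (hD0 i _)]
    exact hdens i
  · have h6 : 6 * γ ^ 2 * B / k = 2 * (3 * γ ^ 2 * B / k) := by ring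
    rw [h6]
    refine le_trans ?_ (mul_le_mul_of_nonneg_left hJ zero_le_two)
    rw [Finset.mul_sum]
    refine Finset.sum_le_sum fun i _ => ?_
    set Q := mixture (cubeWeight γ z) ν
    have hDi : Integrable (D i) Q := Integrable.of_bound (by fun_prop) 2
      (ae_of_all _ fun t => by rw [Real.norm_eq_abs, abs_of_pos (hD0 i t)]; exact (hD i t).2)
    have hD1 : ∫ t, D i t ∂Q = 1 := by
      rw [integral_eq_lintegral_of_nonneg_ae (ae_of_all _ fun t => (hD0 i t).le) (by fun_prop),
        ← setLIntegral_univ, ← withDensity_apply _ MeasurableSet.univ, ← hdens i, measure_univ,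
        ENNReal.toReal_one]
    have hsq : Integrable (fun t => 2 * (D i t - 1) ^ 2) Q := Integrable.of_bound (by fun_prop) 2
      (ae_of_all _ fun t => by
        rw [Real.norm_eq_abs, abs_of_nonneg (by positivity)]
        nlinarith [hD i t])
    have hlm : Measurable fun t => -Real.log (D i t) := (hDm i).log.neg
    have hsub : Integrable (fun t => 1 - D i t) Q := (integrable_const _).sub hDi
    calc ∫ t, -Real.log (D i t) ∂Q ≤ ∫ t, ((1 - D i t) + 2 * (D i t - 1) ^ 2) ∂Q :=
          integral_mono (Integrable.of_bound hlm.aestronglyMeasurable 1 (ae_of_all _ (hlog i)))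
            (hsub.add hsq) fun t => neg_log_le (hD i t).1
      _ = 2 * ∫ t, (D i t - 1) ^ 2 ∂Q := by
          rw [integral_add hsub hsq, integral_sub (integrable_const _) hDi, hD1, integral_const_mul]
          simp

end OneRound

/-! ### The law of the transcript -/

/-- The composition-product with a kernel preserves densities on the first factor. -/
lemma withDensity_compProd {Ω Y : Type*} [MeasurableSpace Ω] [MeasurableSpace Y] (μ : Measure Ω)
    [SFinite μ] (κ : Kernel Ω Y) [IsSFiniteKernel κ] {f : Ω → ℝ≥0∞} (hf : Measurable f) :
    (μ.withDensity f) ⊗ₘ κ = (μ ⊗ₘ κ).withDensity (fun q => f q.1) := by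
  ext s hs
  have hm : Measurable (s.indicator fun q : Ω × Y => f q.1) :=
    (hf.comp measurable_fst).indicator hs
  rw [Measure.compProd_apply hs, withDensity_apply _ hs, ← lintegral_indicator hs,
    Measure.lintegral_compProd hm,
    lintegral_withDensity_eq_lintegral_mul _ hf (Kernel.measurable_kernel_prodMk_left hs)]
  refine lintegral_congr fun ω => ?_
  have h : ∀ y, s.indicator (fun q : Ω × Y => f q.1) (ω, y)
      = (Prod.mk ω ⁻¹' s).indicator (fun _ => f ω) y := fun _ => rfl
  simp only [h]
  rw [lintegral_indicator (measurable_prodMk_left hs)]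
  simp

lemma map_withDensity_comp {Ω T : Type*} [MeasurableSpace Ω] [MeasurableSpace T] (μ : Measure Ω)
    {e : Ω → T} (he : Measurable e) {f : T → ℝ≥0∞} (hf : Measurable f) :
    (μ.withDensity (fun ω => f (e ω))).map e = (μ.map e).withDensity f := by
  ext s hs
  rw [Measure.map_apply he hs, withDensity_apply _ (he hs), withDensity_apply _ hs,
    setLIntegral_map hs hf he]

namespace Protocol

variable {X : Type v} {Y : Type u} [MeasurableSpace X] [MeasurableSpace Y]
  {𝒲 : ChannelFamily X Y} {n : ℕ} (pr : Protocol.{u, v, w} 𝒲 n) (P : ProbabilityMeasure X)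

lemma measurable_selectInput (t : ℕ) (ht : t < n) :
    Measurable (fun q : (pr.U × (Fin t → Y)) × (pr.V ⟨t, ht⟩ × X) =>
      ((q.1.1, q.2.1), (q.2.2, q.1.2))) := by fun_prop

lemma round_apply (t : ℕ) (ht : t < n) (ω : pr.U × (Fin t → Y)) {s : Set Y}
    (hs : MeasurableSet s) :
    pr.round P t ht ω s = ∫⁻ x, ∫⁻ v, pr.channel ⟨t, ht⟩ ((ω.1, v), (x, ω.2)) s
      ∂(pr.lawV ⟨t, ht⟩ : Measure _) ∂(P : Measure X) := by
  have hm := measurable_selectInput pr t ht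
  have hk := Kernel.measurable_coe (pr.channel ⟨t, ht⟩) hs
  have hc : Measurable fun q : (pr.U × (Fin t → Y)) × (pr.V ⟨t, ht⟩ × X) =>
      pr.channel ⟨t, ht⟩ ((q.1.1, q.2.1), (q.2.2, q.1.2)) s := hk.comp hm
  unfold round
  rw [Kernel.comp_apply' _ _ _ hs, Kernel.map_apply _ hm, lintegral_map hk hm, Kernel.prod_apply,
    Kernel.id_apply, Kernel.const_apply, lintegral_prod _ hc.aemeasurable,
    lintegral_dirac' _ hc.lintegral_prod_right']
  exact lintegral_prod_symm _ (hc.comp measurable_prodMk_left).aemeasurable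

instance (t : ℕ) (ht : t < n) : IsMarkovKernel (pr.round P t ht) := by
  have h1 : IsMarkovKernel (((Kernel.id ×ₖ Kernel.const _
      ((pr.lawV ⟨t, ht⟩ : Measure _).prod (P : Measure X))).map
      (fun q : (pr.U × (Fin t → Y)) × (pr.V ⟨t, ht⟩ × X) =>
        ((q.1.1, q.2.1), (q.2.2, q.1.2))))) :=
    Kernel.IsMarkovKernel.map _ (measurable_selectInput pr t ht)
  have h2 := pr.channel_markov ⟨t, ht⟩
  unfold round
  exact Kernel.IsMarkovKernel.comp _ _

lemma measurable_snoc (m : ℕ) :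
    Measurable (fun q : (Fin m → Y) × Y => Fin.snoc (α := fun _ => Y) q.1 q.2) := by
  refine measurable_pi_lambda _ fun i => ?_
  refine Fin.lastCases ?_ (fun j => ?_) i
  · simpa using measurable_snd
  · simpa [Function.comp_def] using (measurable_pi_apply j).comp
      (measurable_fst (α := Fin m → Y) (β := Y))

instance isMarkovKernel_messages : (m : ℕ) → (h : m ≤ n) → IsMarkovKernel (pr.messages P m h)
  | 0, _ => by unfold messages; infer_instance
  | m + 1, h => by
    have := isMarkovKernel_messages m (Nat.le_of_succ_le h)
    unfold messages
    exact Kernel.IsMarkovKernel.map _ (measurable_snoc m)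

/-- The law of the public randomness and the first `m` messages. -/
def partialTranscript (m : ℕ) (h : m ≤ n) : Measure (pr.U × (Fin m → Y)) :=
  (pr.lawU : Measure pr.U) ⊗ₘ pr.messages P m h

instance (m : ℕ) (h : m ≤ n) : IsProbabilityMeasure (pr.partialTranscript P m h) := by
  unfold partialTranscript
  infer_instance

/-- Appends a message to the transcript. -/
def appendMessage (U Y : Type*) (m : ℕ) (q : (U × (Fin m → Y)) × Y) : U × (Fin (m + 1) → Y) :=
  (q.1.1, Fin.snoc (α := fun _ => Y) q.1.2 q.2)

/-- Splits the last message off the transcript. -/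
def splitMessage (U Y : Type*) (m : ℕ) (τ : U × (Fin (m + 1) → Y)) : (U × (Fin m → Y)) × Y :=
  ((τ.1, fun i => τ.2 i.castSucc), τ.2 (Fin.last m))

lemma splitMessage_appendMessage {U Y : Type*} {m : ℕ} (q : (U × (Fin m → Y)) × Y) :
    splitMessage U Y m (appendMessage U Y m q) = q := by
  simp [splitMessage, appendMessage]

lemma measurable_appendMessage {U : Type*} [MeasurableSpace U] (m : ℕ) :
    Measurable (appendMessage U Y m) := by
  unfold appendMessage
  exact (measurable_fst.comp measurable_fst).prodMk ((measurable_snoc m).comp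
    ((measurable_snd.comp measurable_fst).prodMk measurable_snd))

lemma measurable_splitMessage {U : Type*} [MeasurableSpace U] (m : ℕ) :
    Measurable (splitMessage U Y m) := by
  unfold splitMessage
  fun_prop

lemma partialTranscript_succ (m : ℕ) (h : m + 1 ≤ n) :
    pr.partialTranscript P (m + 1) h
      = (pr.partialTranscript P m (Nat.le_of_succ_le h) ⊗ₘ pr.round P m h).map
        (appendMessage pr.U Y m) := by
  ext s hs
  have ha := measurable_appendMessage (U := pr.U) (Y := Y) m
  have hs' := ha hs
  unfold partialTranscript
  rw [Measure.map_apply ha hs, Measure.compProd_apply hs, Measure.compProd_apply hs',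
    Measure.lintegral_compProd (Kernel.measurable_kernel_prodMk_left hs')]
  refine lintegral_congr fun u => ?_
  rw [messages, Kernel.map_apply' _ (measurable_snoc m) _ (measurable_prodMk_left hs),
    Kernel.compProd_apply (measurable_snoc m (measurable_prodMk_left hs))]
  rfl

lemma partialTranscript_zero (P' : ProbabilityMeasure X) :
    pr.partialTranscript P 0 (Nat.zero_le n) = pr.partialTranscript P' 0 (Nat.zero_le n) := rfl

end Protocol

/-! ### Information about the hypercube contained in the transcript -/

/-- The vertex `z` of the hypercube as a point of the simplex: the `k` pairs of symbols are placed
in the alphabet `Fin d` by `e`, and the other symbols have probability `0`. -/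
def cubePoint {k d : ℕ} (hk : 0 < k) {γ : ℝ} (hγ0 : 0 ≤ γ) (hγ : γ ≤ 1 / 3)
    (e : Fin k × Bool ↪ Fin d) (z : Fin k → Bool) : stdSimplex ℝ (Fin d) :=
  ⟨Function.extend e (cubeWeight γ z) 0, by
    intro j
    by_cases h : ∃ a, e a = j
    · obtain ⟨a, rfl⟩ := h
      rw [e.injective.extend_apply]
      exact (cubeWeight_pos hk hγ hγ0 z a).le
    · rw [Function.extend_apply' _ _ _ h]
      rfl, by
    rw [← sum_cubeWeight (γ := γ) hk z]
    refine (Fintype.sum_of_injective e e.injective _ _ (fun j hj => ?_) fun a => ?_).symm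
    · exact Function.extend_apply' _ _ _ hj
    · rw [e.injective.extend_apply]⟩

lemma cubePoint_apply {k d : ℕ} (hk : 0 < k) {γ : ℝ} (hγ0 : 0 ≤ γ) (hγ : γ ≤ 1 / 3)
    (e : Fin k × Bool ↪ Fin d) (z : Fin k → Bool) (a : Fin k × Bool) :
    (cubePoint hk hγ0 hγ e z).1 (e a) = cubeWeight γ z a :=
  e.injective.extend_apply _ _ _

/-- The law of a sample that is always equal to `x`. -/
def pointMass {X : Type v} [MeasurableSpace X] (x : X) : ProbabilityMeasure X :=
  ⟨Measure.dirac x, inferInstance⟩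

lemma lintegral_discreteDist_cubePoint {k d : ℕ} (hk : 0 < k) {γ : ℝ} (hγ0 : 0 ≤ γ)
    (hγ : γ ≤ 1 / 3) (e : Fin k × Bool ↪ Fin d) (z : Fin k → Bool) (f : Fin d → ℝ≥0∞) :
    ∫⁻ x, f x ∂(discreteDist d (cubePoint hk hγ0 hγ e z) : Measure (Fin d))
      = ∑ a, ENNReal.ofReal (cubeWeight γ z a) * f (e a) := by
  have h : (discreteDist d (cubePoint hk hγ0 hγ e z) : Measure (Fin d))
      = ∑ j, ENNReal.ofReal ((cubePoint hk hγ0 hγ e z).1 j) • Measure.dirac j := rfl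
  rw [h, lintegral_finsetSum_measure]
  simp only [lintegral_smul_measure, lintegral_dirac, smul_eq_mul]
  refine (Fintype.sum_of_injective e e.injective _ _ (fun j hj => ?_) fun a => ?_).symm
  · have : (cubePoint hk hγ0 hγ e z).1 j = 0 := Function.extend_apply' _ _ _ hj
    rw [this]
    simp
  · rw [cubePoint_apply]

/-- All rounds of the protocol obey the information bound `B`, whatever the law of the transcript
before the round. -/
def Protocol.HasInformationBound {X : Type v} {Y : Type u} [MeasurableSpace X] [MeasurableSpace Y]
    {𝒲 : ChannelFamily X Y} {n : ℕ} (pr : Protocol.{u, v, w} 𝒲 n) (B : ℝ) : Prop :=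
  ∀ (t : ℕ) (ht : t < n) (μ : Measure (pr.U × (Fin t → Y))), IsProbabilityMeasure μ →
    InteractiveEstimation.HasInformationBound B fun x => μ ⊗ₘ pr.round (pointMass x) t ht

namespace Protocol

variable {Y : Type u} [MeasurableSpace Y] {d n : ℕ} {𝒲 : ChannelFamily (Fin d) Y}
  (pr : Protocol.{u, 0, w} 𝒲 n)

lemma compProd_round_cubePoint {k : ℕ} (hk : 0 < k) {γ : ℝ} (hγ0 : 0 ≤ γ) (hγ : γ ≤ 1 / 3)
    (e : Fin k × Bool ↪ Fin d) (z : Fin k → Bool) {t : ℕ} (ht : t < n)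
    (μ : Measure (pr.U × (Fin t → Y))) [IsProbabilityMeasure μ] :
    μ ⊗ₘ pr.round (discreteDist d (cubePoint hk hγ0 hγ e z)) t ht
      = mixture (cubeWeight γ z) (fun a => μ ⊗ₘ pr.round (pointMass (e a)) t ht) := by
  ext s hs
  simp only [mixture, Measure.finsetSum_apply, Measure.smul_apply, smul_eq_mul,
    Measure.compProd_apply hs]
  have hm : ∀ P, Measurable fun ω => pr.round P t ht ω (Prod.mk ω ⁻¹' s) := fun P =>
    Kernel.measurable_kernel_prodMk_left hs
  simp only [← lintegral_const_mul _ (hm _)]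
  rw [← lintegral_finsetSum _ fun a _ => (hm _).const_mul _]
  refine lintegral_congr fun ω => ?_
  rw [round_apply _ _ _ _ _ (measurable_prodMk_left hs), lintegral_discreteDist_cubePoint]
  refine Finset.sum_congr rfl fun a _ => ?_
  rw [round_apply _ _ _ _ _ (measurable_prodMk_left hs)]
  simp [pointMass]

/-- The chain rule. The log-likelihood ratio of the transcript between two vertices is the sum of
the contributions of the rounds, each of which is controlled by the information bound
uniformly in the past of the round. -/
lemma exists_logLikelihoodRatio {k : ℕ} (hk : 0 < k) {γ : ℝ} (hγ0 : 0 ≤ γ) (hγ : γ ≤ 1 / 3)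
    (e : Fin k × Bool ↪ Fin d) {B : ℝ} (hB0 : 0 ≤ B) (hB : pr.HasInformationBound B)
    (z : Fin k → Bool) (m : ℕ) (h : m ≤ n) :
    ∃ L : Fin k → pr.U × (Fin m → Y) → ℝ, (∀ i, Measurable (L i)) ∧ (∀ i τ, |L i τ| ≤ m) ∧
      (∀ i, pr.partialTranscript (discreteDist d (cubePoint hk hγ0 hγ e (flipCoord z i))) m h
        = (pr.partialTranscript (discreteDist d (cubePoint hk hγ0 hγ e z)) m h).withDensity
          (fun τ => ENNReal.ofReal (Real.exp (-L i τ)))) ∧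
      ∑ i, ∫ τ, L i τ ∂pr.partialTranscript (discreteDist d (cubePoint hk hγ0 hγ e z)) m h
        ≤ m * (6 * γ ^ 2 * B / k) := by
  induction m with
  | zero =>
    refine ⟨fun _ _ => 0, fun _ => measurable_const, by simp, fun i => ?_, by simp⟩
    simp only [neg_zero, Real.exp_zero, ENNReal.ofReal_one]
    rw [show (fun _ : pr.U × (Fin 0 → Y) => (1 : ℝ≥0∞)) = 1 from rfl, withDensity_one]
    exact pr.partialTranscript_zero _ _
  | succ m ih =>
    have hm : m ≤ n := Nat.le_of_succ_le h
    obtain ⟨L, hLm, hL, hdens, hsum⟩ := ih hm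
    set P := discreteDist d (cubePoint hk hγ0 hγ e z) with hP
    set μ := pr.partialTranscript P m hm with hμ
    obtain ⟨K, hKm, hK, hKdens, hKsum⟩ := InteractiveEstimation.exists_logLikelihoodRatio hk hγ0 hγ
      z hB0 (fun a => μ ⊗ₘ pr.round (pointMass (e a)) m h)
      ((hB m h μ inferInstance).imp (fun ⟨Λ, h1, h2⟩ => ⟨Λ, h1, fun a => h2 (e a)⟩)
        fun ⟨r, h0, h1, h2⟩ => ⟨r, h0, h1, fun a b => h2 (e a) (e b)⟩)
    have hmix : ∀ z', μ ⊗ₘ pr.round (discreteDist d (cubePoint hk hγ0 hγ e z')) m h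
      = mixture (cubeWeight γ z') (fun a => μ ⊗ₘ pr.round (pointMass (e a)) m h) := fun z' =>
        pr.compProd_round_cubePoint hk hγ0 hγ e z' h μ
    simp only [← hmix] at hKdens hKsum
    rw [← hP] at hKsum
    have hsm := measurable_splitMessage (U := pr.U) (Y := Y) m
    have ham := measurable_appendMessage (U := pr.U) (Y := Y) m
    have hL'm : ∀ i, Measurable fun τ => L i (splitMessage pr.U Y m τ).1
        + K i (splitMessage pr.U Y m τ) := fun i =>
      ((hLm i).comp (measurable_fst.comp hsm)).add ((hKm i).comp hsm)
    refine ⟨fun i τ => L i (splitMessage pr.U Y m τ).1 + K i (splitMessage pr.U Y m τ),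
      hL'm, fun i τ => ?_, fun i => ?_, ?_⟩
    · push_cast
      exact (abs_add_le _ _).trans (add_le_add (hL _ _) (hK _ _))
    · have hLe : Measurable fun τ => ENNReal.ofReal (Real.exp (-L i τ)) :=
        (hLm i).neg.exp.ennreal_ofReal
      have hKe : Measurable fun τ => ENNReal.ofReal (Real.exp (-K i τ)) :=
        (hKm i).neg.exp.ennreal_ofReal
      have hLe' : Measurable fun q : (pr.U × (Fin m → Y)) × Y =>
          ENNReal.ofReal (Real.exp (-L i q.1)) := hLe.comp measurable_fst
      have hL'e : Measurable fun τ => ENNReal.ofReal (Real.exp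
          (-(L i (splitMessage pr.U Y m τ).1 + K i (splitMessage pr.U Y m τ)))) :=
        (hL'm i).neg.exp.ennreal_ofReal
      rw [partialTranscript_succ, partialTranscript_succ, hdens i, withDensity_compProd _ _ hLe,
        hKdens i, ← withDensity_mul _ hKe hLe',
        ← map_withDensity_comp _ ham hL'e]
      congr 2
      funext q
      simp only [splitMessage_appendMessage, Pi.mul_apply]
      rw [← ENNReal.ofReal_mul (Real.exp_pos _).le, ← Real.exp_add]
      congr 2
      ring
    · have hLi : ∀ i, Integrable (fun q : (pr.U × (Fin m → Y)) × Y => L i q.1)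
          (μ ⊗ₘ pr.round P m h) := fun i =>
        Integrable.of_bound ((hLm i).comp measurable_fst).aestronglyMeasurable m
          (ae_of_all _ fun q => hL i q.1)
      have hKi : ∀ i, Integrable (K i) (μ ⊗ₘ pr.round P m h) := fun i =>
        Integrable.of_bound (hKm i).aestronglyMeasurable 1 (ae_of_all _ (hK i))
      have hLfst : ∀ i, ∫ q, L i q.1 ∂(μ ⊗ₘ pr.round P m h) = ∫ τ, L i τ ∂μ := by
        intro i
        conv_rhs => rw [← Measure.fst_compProd μ (pr.round P m h)]
        rw [Measure.fst, integral_map measurable_fst.aemeasurable (hLm i).aestronglyMeasurable]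
      rw [partialTranscript_succ]
      have hI : ∀ i, ∫ τ, (L i (splitMessage pr.U Y m τ).1 + K i (splitMessage pr.U Y m τ))
          ∂(μ ⊗ₘ pr.round P m h).map (appendMessage pr.U Y m)
          = ∫ τ, L i τ ∂μ + ∫ q, K i q ∂(μ ⊗ₘ pr.round P m h) := by
        intro i
        rw [integral_map ham.aemeasurable (hL'm i).aestronglyMeasurable]
        simp only [splitMessage_appendMessage]
        rw [integral_add (hLi i) (hKi i), hLfst i]
      rw [Finset.sum_congr rfl fun i _ => hI i, Finset.sum_add_distrib]
      push_cast
      linarith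

end Protocol

/-! ### Assouad's method -/

/-- Pinsker's inequality in linear form, before integration: the overlap of two measures is large
if their log-likelihood ratio `L` is small on average. -/
lemma le_min_one_exp_neg (L : ℝ) :
    3 / 4 - 2 * (L + Real.exp (-L) - 1) ≤ min 1 (Real.exp (-L)) := by
  have h1 := Real.add_one_le_exp (-L)
  refine le_min (by linarith) ?_
  -- The tangent to `exp (-L)` at the minimizer `L = log (3 / 2)` of `3 * exp (-L) + 2 * L`.
  have h2 : 3 * Real.exp (-L) ≥ 2 * (1 + (Real.log (3 / 2) - L)) := by
    have h3 := Real.add_one_le_exp (Real.log (3 / 2) - L)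
    rw [sub_eq_add_neg, Real.exp_add, Real.exp_log (by norm_num)] at h3
    linarith
  have h4 : (3 : ℝ) / 8 ≤ Real.log (3 / 2) := by
    rw [Real.le_log_iff_exp_le (by norm_num)]
    refine le_of_pow_le_pow_left₀ (n := 8) (by norm_num) (by norm_num) ?_
    rw [← Real.exp_nat_mul]
    have h5 : Real.exp ((8 : ℕ) * (3 / 8)) = Real.exp 1 ^ 3 := by
      rw [← Real.exp_nat_mul]
      norm_num
    rw [h5]
    calc Real.exp 1 ^ 3 ≤ (2.72 : ℝ) ^ 3 := by
          gcongr
          linarith [Real.exp_one_lt_d9]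
      _ ≤ (3 / 2) ^ 8 := by norm_num
  linarith

/-- Two hypotheses cannot both have a small loss if they are hard to tell apart. -/
lemma ofReal_le_lintegral_add_lintegral {T : Type*} [MeasurableSpace T] {μ μ' : Measure T}
    [IsProbabilityMeasure μ] [IsProbabilityMeasure μ'] {L : T → ℝ} (hLm : Measurable L) {C : ℝ}
    (hL : ∀ t, |L t| ≤ C)
    (hμ' : μ' = μ.withDensity (fun t => ENNReal.ofReal (Real.exp (-L t)))) {f g : T → ℝ≥0∞}
    (hf : Measurable f) (hg : Measurable g) {c : ℝ} (hc : 0 ≤ c)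
    (hfg : ∀ t, ENNReal.ofReal c ≤ f t + g t) :
    ENNReal.ofReal (c * (3 / 4 - 2 * ∫ t, L t ∂μ)) ≤ ∫⁻ t, f t ∂μ + ∫⁻ t, g t ∂μ' := by
  have hem : Measurable fun t => Real.exp (-L t) := hLm.neg.exp
  have hei : Integrable (fun t => Real.exp (-L t)) μ :=
    Integrable.of_bound hem.aestronglyMeasurable (Real.exp C) (ae_of_all _ fun t => by
      rw [Real.norm_eq_abs, abs_of_pos (Real.exp_pos _), Real.exp_le_exp]
      linarith [neg_le_of_abs_le (hL t)])
  have hLi : Integrable L μ := Integrable.of_bound hLm.aestronglyMeasurable C (ae_of_all _ hL)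
  have he1 : ∫ t, Real.exp (-L t) ∂μ = 1 := by
    rw [integral_eq_lintegral_of_nonneg_ae (ae_of_all _ fun t => (Real.exp_pos _).le)
      hem.aestronglyMeasurable, ← setLIntegral_univ, ← withDensity_apply _ MeasurableSet.univ,
      ← hμ', measure_univ, ENNReal.toReal_one]
  have hmin : Integrable (fun t => min 1 (Real.exp (-L t))) μ := (integrable_const 1).inf hei
  have hadd : Integrable (fun t => L t + Real.exp (-L t)) μ := hLi.add hei
  have hlow : Integrable (fun t => L t + Real.exp (-L t) - 1) μ :=
    hadd.sub (integrable_const 1)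
  have hint : 3 / 4 - 2 * ∫ t, L t ∂μ ≤ ∫ t, min 1 (Real.exp (-L t)) ∂μ := by
    calc 3 / 4 - 2 * ∫ t, L t ∂μ
        = ∫ t, (3 / 4 - 2 * (L t + Real.exp (-L t) - 1)) ∂μ := by
          have h1 : ∫ t, (L t + Real.exp (-L t) - 1) ∂μ = ∫ t, L t ∂μ := by
            rw [integral_sub hadd (integrable_const 1), integral_add hLi hei, he1]
            simp
          rw [integral_sub (integrable_const _) (hlow.const_mul 2), integral_const_mul, h1]
          simp
      _ ≤ _ := integral_mono ((integrable_const _).sub (hlow.const_mul 2)) hmin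
          fun t => le_min_one_exp_neg (L t)
  rw [hμ', lintegral_withDensity_eq_lintegral_mul _ hem.ennreal_ofReal hg, ← lintegral_add_left hf]
  calc ENNReal.ofReal (c * (3 / 4 - 2 * ∫ t, L t ∂μ))
      ≤ ENNReal.ofReal (∫ t, c * min 1 (Real.exp (-L t)) ∂μ) := by
        rw [integral_const_mul]
        gcongr
    _ = ∫⁻ t, ENNReal.ofReal (c * min 1 (Real.exp (-L t))) ∂μ :=
        ofReal_integral_eq_lintegral_ofReal (hmin.const_mul c)
          (ae_of_all _ fun t => mul_nonneg hc (le_min zero_le_one (Real.exp_pos _).le))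
    _ ≤ _ := by
        refine lintegral_mono fun t => ?_
        have h1 : ENNReal.ofReal (min 1 (Real.exp (-L t))) ≤ 1 :=
          ENNReal.ofReal_le_one.2 (min_le_left _ _)
        have h2 : ENNReal.ofReal (min 1 (Real.exp (-L t))) ≤ ENNReal.ofReal (Real.exp (-L t)) :=
          ENNReal.ofReal_le_ofReal (min_le_right _ _)
        calc ENNReal.ofReal (c * min 1 (Real.exp (-L t)))
            = ENNReal.ofReal (min 1 (Real.exp (-L t))) * ENNReal.ofReal c := by
              rw [ENNReal.ofReal_mul hc, mul_comm]
          _ ≤ ENNReal.ofReal (min 1 (Real.exp (-L t))) * (f t + g t) := by gcongr; exact hfg t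
          _ ≤ f t + ENNReal.ofReal (Real.exp (-L t)) * g t := by
              rw [mul_add]
              gcongr
              exact mul_le_of_le_one_left zero_le h1

/-- The averaging step of Assouad's method. Here `a z i` is the expected loss at the vertex `z` in
the `i`-th coordinate, and `K z i` the divergence of the `i`-th neighbour of `z` from `z`. -/
lemma assouad_average {k : ℕ} {c ε : ℝ} (hc : 0 ≤ c) {a K : (Fin k → Bool) → Fin k → ℝ}
    (h : ∀ z i, c * (3 / 4 - 2 * K z i) ≤ a z i + a (flipCoord z i) i)
    (hK : ∀ z, ∑ i, K z i ≤ k / 4) (ha : ∀ z, ∑ i, a z i ≤ ε) : c * k / 8 ≤ ε := by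
  have hflip : ∑ z, ∑ i, a (flipCoord z i) i = ∑ z, ∑ i, a z i := by
    rw [Finset.sum_comm, Finset.sum_comm (f := fun z i => a z i)]
    refine Finset.sum_congr rfl fun i _ => ?_
    have hinv : Function.Involutive fun z : Fin k → Bool => flipCoord z i :=
      fun z => flipCoord_flipCoord z i
    exact Equiv.sum_comp (hinv.toPerm _) fun z => a z i
  have h1 : ∑ z : Fin k → Bool, c * k / 4 ≤ ∑ z : Fin k → Bool, 2 * ε := by
    calc ∑ z : Fin k → Bool, c * k / 4
        ≤ ∑ z, ∑ i, c * (3 / 4 - 2 * K z i) := by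
          refine Finset.sum_le_sum fun z _ => ?_
          rw [← Finset.mul_sum, Finset.sum_sub_distrib, ← Finset.mul_sum]
          simp only [Finset.sum_const, Finset.card_univ, Fintype.card_fin, nsmul_eq_mul]
          nlinarith [hK z, mul_le_mul_of_nonneg_left (hK z) hc]
      _ ≤ ∑ z, ∑ i, (a z i + a (flipCoord z i) i) :=
          Finset.sum_le_sum fun z _ => Finset.sum_le_sum fun i _ => h z i
      _ = ∑ z, 2 * ∑ i, a z i := by
          simp only [Finset.sum_add_distrib]
          rw [hflip, ← Finset.mul_sum, two_mul]
      _ ≤ ∑ z : Fin k → Bool, 2 * ε :=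
          Finset.sum_le_sum fun z _ => mul_le_mul_of_nonneg_left (ha z) zero_le_two
  simp only [Finset.sum_const, Finset.card_univ, nsmul_eq_mul] at h1
  have h2 : (0 : ℝ) < Fintype.card (Fin k → Bool) := by
    exact_mod_cast Fintype.card_pos
  have h3 := le_of_mul_le_mul_left h1 h2
  linarith

/-- The separation of neighbouring vertices, in one symbol of the flipped pair. -/
lemma ofReal_rpow_le_add_flip {k : ℕ} {γ p : ℝ} (hγ0 : 0 ≤ γ) (hp : 0 ≤ p) (z : Fin k → Bool)
    (i : Fin k) (b : Bool) (x : ℝ) :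
    ENNReal.ofReal ((γ / (2 * k)) ^ p) ≤ ENNReal.ofReal (|cubeWeight γ z (i, b) - x| ^ p)
      + ENNReal.ofReal (|cubeWeight γ (flipCoord z i) (i, b) - x| ^ p) := by
  have hsep : γ / k ≤ |cubeWeight γ z (i, b) - cubeWeight γ (flipCoord z i) (i, b)| := by
    have : cubeWeight γ z (i, b) - cubeWeight γ (flipCoord z i) (i, b)
        = γ / k * (if z i = b then 1 else -1) := by
      by_cases hk : (k : ℝ) = 0
      · simp [cubeWeight, hk]
      unfold cubeWeight
      simp only [flipCoord_self]
      cases z i <;> cases b <;> simp <;> field_simp <;> ring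
    rw [this, abs_mul]
    split_ifs <;> simp [le_abs_self]
  have htri := abs_sub_le (cubeWeight γ z (i, b)) x (cubeWeight γ (flipCoord z i) (i, b))
  rw [abs_sub_comm x] at htri
  have h2 : γ / k = 2 * (γ / (2 * k)) := by ring
  have h0 : 0 ≤ γ / (2 * k) := by positivity
  rcases le_total (γ / (2 * k)) |cubeWeight γ z (i, b) - x| with h | h
  · exact le_add_right (ENNReal.ofReal_le_ofReal (Real.rpow_le_rpow h0 h hp))
  · exact le_add_left (ENNReal.ofReal_le_ofReal (Real.rpow_le_rpow h0 (by linarith) hp))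

section LowerBound

variable {Y : Type u} [MeasurableSpace Y] {d n : ℕ} {𝒲 : ChannelFamily (Fin d) Y}

lemma IsEstimator.lintegral_le {p δ : ℝ} (hp : 1 ≤ p) (hδ : 0 ≤ δ) {pr : Protocol.{u, 0, w} 𝒲 n}
    {θhat : pr.U × (Fin n → Y) → stdSimplex ℝ (Fin d)}
    (h : IsEstimator (discreteDist d) p δ pr θhat) (θ : stdSimplex ℝ (Fin d)) :
    ∫⁻ τ, ∑ j, ENNReal.ofReal (|θ.1 j - (θhat τ).1 j| ^ p) ∂pr.transcript (discreteDist d θ)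
      ≤ ENNReal.ofReal (δ ^ p) := by
  have hp0 : 0 < p := by linarith
  have h1 := h.2 θ
  rw [one_div, ENNReal.rpow_inv_le_iff hp0, ENNReal.ofReal_rpow_of_nonneg hδ hp0.le] at h1
  refine le_of_eq_of_le (lintegral_congr fun τ => ?_) h1
  have h0 : ∀ j, 0 ≤ |θ.1 j - (θhat τ).1 j| ^ p := fun j => by positivity
  rw [← ENNReal.ofReal_sum_of_nonneg fun j _ => h0 j]
  unfold lpDist
  have hs := Finset.sum_nonneg fun j (_ : j ∈ Finset.univ) => h0 j
  rw [ENNReal.ofReal_rpow_of_nonneg (Real.rpow_nonneg hs _) hp0.le, ← Real.rpow_mul hs,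
    one_div_mul_cancel hp0.ne', Real.rpow_one]

/-- The lower bound of Assouad's method for protocols that obey an information bound. -/
lemma rpow_le_of_isEstimator {k : ℕ} (hk : 0 < k) (hkd : 2 * k ≤ d) {γ : ℝ} (hγ0 : 0 ≤ γ)
    (hγ : γ ≤ 1 / 3) {B : ℝ} (hB0 : 0 ≤ B) (hγB : 24 * γ ^ 2 * (n * B) ≤ k ^ 2)
    {p δ : ℝ} (hp : 1 ≤ p) (hδ : 0 ≤ δ) {pr : Protocol.{u, 0, w} 𝒲 n}
    (hB : pr.HasInformationBound B)
    {θhat : pr.U × (Fin n → Y) → stdSimplex ℝ (Fin d)}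
    (h : IsEstimator (discreteDist d) p δ pr θhat) :
    k / 4 * (γ / (2 * k)) ^ p ≤ δ ^ p := by
  obtain ⟨e⟩ : Nonempty (Fin k × Bool ↪ Fin d) := by
    refine Function.Embedding.nonempty_of_card_le ?_
    simp only [Fintype.card_prod, Fintype.card_fin, Fintype.card_bool]
    linarith
  have hk' : (0 : ℝ) < k := by positivity
  choose L hLm hL hdens hsum using
    fun z => pr.exists_logLikelihoodRatio hk hγ0 hγ e hB0 hB z n le_rfl
  set M : (Fin k → Bool) → Measure (pr.U × (Fin n → Y)) := fun z =>
    pr.partialTranscript (discreteDist d (cubePoint hk hγ0 hγ e z)) n le_rfl with hM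
  have hMp : ∀ z, IsProbabilityMeasure (M z) := fun z => by rw [hM]; infer_instance
  set f : (Fin k → Bool) → Fin k → Bool → pr.U × (Fin n → Y) → ℝ≥0∞ := fun z i b τ =>
    ENNReal.ofReal (|cubeWeight γ z (i, b) - (θhat τ).1 (e (i, b))| ^ p) with hf
  have hfm : ∀ z i b, Measurable (f z i b) := by
    intro z i b
    have h1 : Measurable fun τ => (θhat τ).1 (e (i, b)) :=
      (measurable_pi_apply _).comp (measurable_subtype_coe.comp h.1)
    exact ((measurable_const.sub h1).norm.pow_const p).ennreal_ofReal
  have hFm : ∀ z i, Measurable fun τ => ∑ b, f z i b τ := fun z i =>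
    Finset.measurable_fun_sum _ fun b _ => hfm z i b
  -- The loss in the symbols of the hypercube is at most the total loss.
  have hloss : ∀ z, ∑ i, ∫⁻ τ, ∑ b, f z i b τ ∂M z ≤ ENNReal.ofReal (δ ^ p) := by
    intro z
    rw [← lintegral_finsetSum _ fun i _ => hFm z i]
    refine le_trans (lintegral_mono fun τ => ?_)
      (h.lintegral_le hp hδ (cubePoint hk hγ0 hγ e z))
    simp only [hf]
    rw [← Fintype.sum_prod_type' (fun i b => ENNReal.ofReal
      (|cubeWeight γ z (i, b) - (θhat τ).1 (e (i, b))| ^ p))]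
    simp only [← cubePoint_apply hk hγ0 hγ e]
    rw [← Finset.sum_map Finset.univ e (fun j => ENNReal.ofReal
      (|(cubePoint hk hγ0 hγ e z).1 j - (θhat τ).1 j| ^ p))]
    exact Finset.sum_le_sum_of_subset (Finset.subset_univ _)
  have hfin : ∀ z i, ∫⁻ τ, ∑ b, f z i b τ ∂M z ≠ ∞ := fun z i =>
    (((Finset.single_le_sum (f := fun i => ∫⁻ τ, ∑ b, f z i b τ ∂M z) (fun _ _ => zero_le)
      (Finset.mem_univ i)).trans (hloss z)).trans_lt ENNReal.ofReal_lt_top).ne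
  have hΔ : 0 ≤ (γ / (2 * k)) ^ p := by positivity
  have hmain := assouad_average (c := 2 * (γ / (2 * k)) ^ p) (ε := δ ^ p) (by positivity)
    (a := fun z i => (∫⁻ τ, ∑ b, f z i b τ ∂M z).toReal)
    (K := fun z i => ∫ τ, L z i τ ∂M z) ?_ ?_ ?_
  · linarith
  · intro z i
    have h2 := ofReal_le_lintegral_add_lintegral (hLm z i) (hL z i) (hdens z i) (hFm z i)
      (hFm (flipCoord z i) i) (c := 2 * (γ / (2 * k)) ^ p) (by positivity) fun τ => by
        rw [two_mul, ENNReal.ofReal_add hΔ hΔ, ← Finset.sum_add_distrib, Fintype.sum_bool]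
        exact add_le_add (ofReal_rpow_le_add_flip hγ0 (by linarith) z i true _)
          (ofReal_rpow_le_add_flip hγ0 (by linarith) z i false _)
    rw [ENNReal.ofReal_le_iff_le_toReal (ENNReal.add_ne_top.2 ⟨hfin z i, hfin _ i⟩),
      ENNReal.toReal_add (hfin z i) (hfin _ i)] at h2
    exact h2
  · intro z
    refine (hsum z).trans ?_
    rw [← mul_div_assoc, div_le_iff₀ hk']
    nlinarith
  · intro z
    rw [← ENNReal.toReal_sum fun i _ => hfin z i]
    exact ENNReal.toReal_le_of_le_ofReal (by positivity) (hloss z)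

/-! ### Choice of the parameters -/

/-- The hypercube uses about `min d √N` symbols, and a perturbation `γ` of order `k / √N`. -/
lemma exists_parameters {p : ℝ} (hp : 1 ≤ p) {d : ℕ} (hd : 2 ≤ d) {N : ℝ} (hN : 0 < N) :
    ∃ (k : ℕ) (γ : ℝ), 0 < k ∧ 2 * k ≤ d ∧ 0 ≤ γ ∧ γ ≤ 1 / 3 ∧ 24 * γ ^ 2 * N ≤ k ^ 2 ∧
      1 / 120 * discreteBound p d N ≤ (k : ℝ) ^ (1 / p) * γ / (8 * k) := by
  have hp0 : 0 < p := by linarith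
  -- For `N ≤ 1` a single pair of symbols gives a constant lower bound, while `discreteBound ≤ 1`.
  rcases le_total N 1 with hN1 | hN1
  · refine ⟨1, 1 / 5, one_pos, by linarith, by norm_num, by norm_num, by norm_num; linarith, ?_⟩
    have : discreteBound p d N ≤ 1 := min_le_right _ _
    simp only [Nat.cast_one, Real.one_rpow]
    linarith
  set s := √N with hs
  have hs1 : 1 ≤ s := Real.one_le_sqrt.2 hN1
  have hs0 : 0 < s := by linarith
  have hss : s ^ 2 = N := Real.sq_sqrt hN.le
  set k := min (d / 2) ⌊s⌋₊ with hk
  have hk1 : 1 ≤ k := le_min (by omega) (Nat.le_floor (by simpa using hs1))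
  have hk1' : (1 : ℝ) ≤ k := by exact_mod_cast hk1
  have hks : (k : ℝ) ≤ s := le_trans (by exact_mod_cast min_le_right _ _) (Nat.floor_le hs0.le)
  have hkd : 2 * k ≤ d := by omega
  -- Rounding costs a factor of at most `3`, attained at `d = 3`.
  have hlow : 1 / 3 * min (d : ℝ) s ≤ k := by
    rcases le_total (d / 2) ⌊s⌋₊ with h | h
    · have h1 : d ≤ 3 * k := by omega
      have h2 : (d : ℝ) ≤ 3 * k := by exact_mod_cast h1
      linarith [min_le_left (d : ℝ) s]
    · rw [min_eq_right h] at hk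
      have := Nat.lt_floor_add_one s
      rw [← hk] at this
      linarith [min_le_right (d : ℝ) s]
  refine ⟨k, k / (5 * s), hk1, hkd, by positivity, ?_, ?_, ?_⟩
  · rw [div_le_iff₀ (by positivity)]
    linarith
  · rw [← hss]
    field_simp
    norm_num
  · have hm0 : 0 < min (d : ℝ) s := lt_min (by positivity) hs0
    have hbound : discreteBound p d N ≤ (min (d : ℝ) s) ^ (1 / p) / s := by
      refine (min_le_left _ _).trans ?_
      rw [Real.sqrt_le_left (by positivity)]
      have hsq : ∀ x : ℝ, 0 ≤ x → (x ^ (1 / p) / s) ^ 2 = x ^ (2 / p) / N := by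
        intro x hx
        rw [div_pow, hss, ← Real.rpow_natCast, ← Real.rpow_mul hx]
        congr 2
        push_cast
        ring
      rcases le_total (d : ℝ) s with h | h
      · rw [min_eq_left h, hsq _ (by positivity)]
        exact min_le_left _ _
      · rw [min_eq_right h, hsq _ hs0.le]
        refine (min_le_right _ _).trans (le_of_eq ?_)
        rw [← hss, one_div, Real.inv_rpow (by positivity), ← Real.rpow_natCast s 2,
          ← Real.rpow_mul hs0.le, ← Real.rpow_neg hs0.le, ← Real.rpow_sub hs0]
        congr 1
        push_cast
        field_simp
        ring
    have hthird : (1 : ℝ) / 3 * (min (d : ℝ) s) ^ (1 / p) ≤ (k : ℝ) ^ (1 / p) := by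
      have h1 : (1 / 3 : ℝ) ≤ (1 / 3 : ℝ) ^ (1 / p) := by
        conv_lhs => rw [← Real.rpow_one (1 / 3 : ℝ)]
        refine Real.rpow_le_rpow_of_exponent_ge (by norm_num) (by norm_num) ?_
        rw [div_le_one hp0]
        exact hp
      calc (1 : ℝ) / 3 * (min (d : ℝ) s) ^ (1 / p)
          ≤ (1 / 3 : ℝ) ^ (1 / p) * (min (d : ℝ) s) ^ (1 / p) := by gcongr
        _ = (1 / 3 * min (d : ℝ) s) ^ (1 / p) := (Real.mul_rpow (by norm_num) hm0.le).symm
        _ ≤ (k : ℝ) ^ (1 / p) := by gcongr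
    calc 1 / 120 * discreteBound p d N ≤ 1 / 120 * ((min (d : ℝ) s) ^ (1 / p) / s) := by gcongr
      _ = (1 / 3 * (min (d : ℝ) s) ^ (1 / p)) / (40 * s) := by ring
      _ ≤ (k : ℝ) ^ (1 / p) / (40 * s) := by gcongr
      _ = (k : ℝ) ^ (1 / p) * (k / (5 * s)) / (8 * k) := by
        field_simp
        norm_num

/-- The lower bound for the minimax rate if all protocols obey the information bound `B`. -/
theorem ofReal_le_minimaxRate {p : ℝ} (hp : 1 ≤ p) (hd : 2 ≤ d) (hn : 1 ≤ n) {B : ℝ} (hB0 : 0 < B)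
    (hB : ∀ pr : Protocol.{u, 0, w} 𝒲 n, pr.HasInformationBound B) :
    ENNReal.ofReal (1 / 120 * discreteBound p d (n * B))
      ≤ minimaxRate.{u, 0, w} p (discreteDist d) 𝒲 n := by
  have hp0 : 0 < p := by linarith
  have hn0 : (0 : ℝ) < n := by exact_mod_cast hn
  obtain ⟨k, γ, hk, hkd, hγ0, hγ, hγB, hbound⟩ := exists_parameters hp hd (mul_pos hn0 hB0)
  refine le_sInf ?_
  rintro _ ⟨δ, ⟨hδ, -, pr, θhat, hest⟩, rfl⟩
  refine ENNReal.ofReal_le_ofReal (hbound.trans ?_)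
  have hk' : (0 : ℝ) < k := by positivity
  have h := rpow_le_of_isEstimator hk hkd hγ0 hγ hB0.le hγB hp hδ.le (hB pr) hest
  refine (Real.rpow_le_rpow_iff (by positivity) hδ.le hp0).1 (le_trans ?_ h)
  have h4 : (1 / 4 : ℝ) ^ p ≤ 1 / 4 := by
    conv_rhs => rw [← Real.rpow_one (1 / 4 : ℝ)]
    exact Real.rpow_le_rpow_of_exponent_ge (by norm_num) (by norm_num) hp
  calc ((k : ℝ) ^ (1 / p) * γ / (8 * k)) ^ p
      = ((k : ℝ) ^ (1 / p) * (1 / 4) * (γ / (2 * k))) ^ p := by congr 1; ring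
    _ = k * (1 / 4) ^ p * (γ / (2 * k)) ^ p := by
        rw [Real.mul_rpow (by positivity) (by positivity), Real.mul_rpow (by positivity)
          (by positivity), ← Real.rpow_mul hk'.le, one_div_mul_cancel hp0.ne', Real.rpow_one]
    _ ≤ k * (1 / 4) * (γ / (2 * k)) ^ p := by gcongr
    _ = k / 4 * (γ / (2 * k)) ^ p := by ring

end LowerBound

/-! ### Information bounds of the two constraints -/

section Constraints

lemma compProd_mono_right {Ω Y : Type*} [MeasurableSpace Ω] [MeasurableSpace Y] (μ : Measure Ω)
    [SFinite μ] {κ η : Kernel Ω Y} [IsSFiniteKernel κ] [IsSFiniteKernel η]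
    (h : ∀ ω s, MeasurableSet s → κ ω s ≤ η ω s) : μ ⊗ₘ κ ≤ μ ⊗ₘ η := by
  refine Measure.le_intro fun s hs _ => ?_
  rw [Measure.compProd_apply hs, Measure.compProd_apply hs]
  exact lintegral_mono fun ω => h ω _ (measurable_prodMk_left hs)

lemma compProd_le_smul {Ω Y : Type*} [MeasurableSpace Ω] [MeasurableSpace Y] (μ : Measure Ω)
    [SFinite μ] {κ η : Kernel Ω Y} [IsSFiniteKernel κ] [IsSFiniteKernel η] {c : ℝ≥0∞}
    (h : ∀ ω s, MeasurableSet s → κ ω s ≤ c * η ω s) : μ ⊗ₘ κ ≤ c • (μ ⊗ₘ η) := by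
  refine Measure.le_intro fun s hs _ => ?_
  rw [Measure.smul_apply, smul_eq_mul, Measure.compProd_apply hs, Measure.compProd_apply hs,
    ← lintegral_const_mul _ (Kernel.measurable_kernel_prodMk_left hs)]
  exact lintegral_mono fun ω => h ω _ (measurable_prodMk_left hs)

variable {Y : Type u} [MeasurableSpace Y] {d n : ℕ}

lemma Protocol.round_pointMass_le {ε : ℝ} (pr : Protocol.{u, 0, w} (ldpChannels (Fin d) Y ε) n)
    (t : ℕ) (ht : t < n) (x x' : Fin d) (ω : pr.U × (Fin t → Y)) (s : Set Y)
    (hs : MeasurableSet s) :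
    pr.round (pointMass x) t ht ω s
      ≤ ENNReal.ofReal (Real.exp ε) * pr.round (pointMass x') t ht ω s := by
  rw [Protocol.round_apply _ _ _ _ _ hs, Protocol.round_apply _ _ _ _ _ hs]
  simp only [pointMass, ProbabilityMeasure.coe_mk, lintegral_dirac]
  rw [← lintegral_const_mul' _ _ ENNReal.ofReal_ne_top]
  exact lintegral_mono fun v => (pr.channel_mem ⟨t, ht⟩ ω.1 v).2 s hs ω.2 x x'

/-- Local differential privacy gives both forms of the information bound: the likelihood ratios
are at most `exp ε`, and the laws of the message have a common upper bound of mass `exp ε`. -/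
lemma Protocol.hasInformationBound_of_ldp (hd : 0 < d) {ε : ℝ} (hε : 0 ≤ ε)
    (pr : Protocol.{u, 0, w} (ldpChannels (Fin d) Y ε) n) :
    pr.HasInformationBound (min ((Real.exp ε - 1) ^ 2) (Real.exp ε)) := by
  intro t ht μ hμ
  have hle : ∀ x x', μ ⊗ₘ pr.round (pointMass x) t ht
      ≤ ENNReal.ofReal (Real.exp ε) • (μ ⊗ₘ pr.round (pointMass x') t ht) := fun x x' =>
    compProd_le_smul μ (pr.round_pointMass_le t ht x x')
  rcases min_choice ((Real.exp ε - 1) ^ 2) (Real.exp ε) with h | h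
  · rw [h]
    refine Or.inr ⟨Real.exp ε - 1, by linarith [Real.one_le_exp hε], rfl, fun x x' => ?_⟩
    rw [add_sub_cancel]
    exact hle x x'
  · rw [h]
    refine Or.inl ⟨ENNReal.ofReal (Real.exp ε) • (μ ⊗ₘ pr.round (pointMass ⟨0, hd⟩) t ht), ?_,
      fun x => hle x _⟩
    rw [Measure.smul_apply, measure_univ, smul_eq_mul, mul_one]

/-- The laws of an `ℓ`-bit message are bounded by the counting measure, which has mass `2 ^ ℓ`. -/
lemma Protocol.hasInformationBound_of_comm {ℓ : ℕ}
    (pr : Protocol.{0, 0, w} (commChannels (Fin d) ℓ) n) :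
    pr.HasInformationBound (2 ^ ℓ) := by
  intro t ht μ hμ
  refine Or.inl ⟨μ ⊗ₘ Kernel.const _ Measure.count, ?_, fun x => compProd_mono_right μ ?_⟩
  · rw [Measure.compProd_apply MeasurableSet.univ]
    simp [Measure.count_apply, ENNReal.ofReal_pow]
  · intro ω s hs
    rw [Kernel.const_apply]
    rcases s.eq_empty_or_nonempty with rfl | ⟨y, hy⟩
    · simp
    · refine prob_le_one.trans ?_
      rw [← Measure.count_singleton y]
      exact measure_mono (Set.singleton_subset_iff.2 hy)

end Constraints

end

end InteractiveEstimation

theorem mainTheorem5 :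
    ∃ c : ℝ, 0 < c ∧ ∀ (p : ℝ) (d n : ℕ), 1 ≤ p → 2 ≤ d → 1 ≤ n →
      (∀ ε : ℝ, 0 < ε → ∀ (Y : Type u) [MeasurableSpace Y],
        ENNReal.ofReal (c * InteractiveEstimation.discreteBound p d
            (n * min ((Real.exp ε - 1) ^ 2) (Real.exp ε))) ≤
          InteractiveEstimation.minimaxRate.{u, 0, w} p (InteractiveEstimation.discreteDist d)
            (InteractiveEstimation.ldpChannels (Fin d) Y ε) n) ∧
      (∀ ℓ : ℕ, 1 ≤ ℓ →
        ENNReal.ofReal (c * InteractiveEstimation.discreteBound p d (n * 2 ^ ℓ)) ≤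
          InteractiveEstimation.minimaxRate.{0, 0, w} p (InteractiveEstimation.discreteDist d)
            (InteractiveEstimation.commChannels (Fin d) ℓ) n) := by
  refine ⟨1 / 120, by norm_num, fun p d n hp hd hn => ⟨fun ε hε Y _ => ?_, fun ℓ _ => ?_⟩⟩
  · refine InteractiveEstimation.ofReal_le_minimaxRate hp hd hn
      (lt_min ?_ (Real.exp_pos ε)) fun pr => pr.hasInformationBound_of_ldp (by omega) hε.le
    have : 0 < Real.exp ε - 1 := by linarith [Real.add_one_lt_exp hε.ne']
    positivity
  · exact InteractiveEstimation.ofReal_le_minimaxRate hp hd hn (by positivity)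
      fun pr => pr.hasInformationBound_of_comm
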